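/- Let $q$ be a prime power and let $n\ge 1$ be an integer with $q\ge n$. Write the points of $\mathrm{PG}(2,q^n)$ as $(a,b,c)_{\mathbb F_{q^n}}$ with $a,b,c\in\mathbb F_{q^n}$ not all zero, and the points of $\mathrm{PG}(2n,q)$ as $(a,b,c)_{\mathbb F_q}$ with $a,b\in\mathbb F_{q^n}$, $c\in\mathbb F_q$ not all zero. Let $l_\infty$ be the line $c=0$ of $\mathrm{PG}(2,q^n)$ and $H_\infty$ the hyperplane $c=0$ of $\mathrm{PG}(2n,q)$; points of $\mathrm{PG}(2n,q)$ not in $H_\infty$ are called affine. The ABB-map $\phi$ sends $(a,b,1)_{\mathbb F_{q^n}}$ to the point $(a,b,1)_{\mathbb F_q}$ and $(a,b,0)_{\mathbb F_{q^n}}$ to the $(n-1)$-space $\{(ax,bx,0)_{\mathbb F_q}\mid x\in\mathbb F_{q^n}^*\}$. For $k\mid n$ let $$\mathcal D_k=\bigl\{\{(ax,bx,0)_{\mathbb F_q}\mid x\in\mathbb F_{q^k}^*\}\ \big|\ a,b\in\mathbb F_{q^n},\ (a,b)\ne(0,0)\bigr\}.$$ An $\mathbb F_{q^k}$-subline of $\mathrm{PG}(2,q^n)$,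 $k\mid n$, is a set $\{(su+tv)_{\mathbb F_{q^n}}\mid s,t\in\mathbb F_{q^k},\ (s,t)\neq(0,0)\}$ with $u,v\in\mathbb F_{q^n}^3$ linearly independent over $\mathbb F_{q^n}$; it is external to $l_\infty$ if it has no point on $l_\infty$, and tangent to $l_\infty$ if it has exactly one point on $l_\infty$. A normal rational curve of degree $d$, $2\le d\le q$, in $\mathrm{PG}(2n,q)$ is a set $\{(\sum_{i=0}^{d}s^{d-i}t^{i}e_i)_{\mathbb F_q}\mid s,t\in\mathbb F_q,\ (s,t)\ne(0,0)\}$ with $e_0,\dots,e_d$ linearly independent over $\mathbb F_q$. **Corollary 2.7.** Let $m$ be an $\mathbb F_{q^k}$-subline of $\mathrm{PG}(2,q^n)$ external to $l_\infty$, and suppose that the smallest subline (the one over the smallest field) that contains $m$ and is tangent to $l_\infty$ is an $\mathbb F_{q^r}$-subline. Then $M=\phi(m)$ is a set of $q^k+1$ affine points of $\mathrm{PG}(2n,q)$, no three collinear, and $M$ is contained in an $r$-dimensional projective subspace of $\mathrm{PG}(2n,q)$ that meets $H_\infty$ exactly in an element of $\mathcal D_r$. Moreover, any three distinct points of $M$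 determine an affine normal rational curve contained in $M$: there is exactly one $\mathbb F_q$-subline $m_0$ of $\mathrm{PG}(2,q^n)$ whose ABB-image $\phi(m_0)$ contains the three points, and $\phi(m_0)$ is a normal rational curve of some degree $d$ with $2\le d\le q$, all of whose points are affine and belong to $M$. -/

import Mathlib

/-!
Here `K` is the field with `q` elements and `L` its extension of degree `n`. The plane
PG(2, q^n) is `ℙ L (L × L × L)`, and PG(2n, q) is `ℙ K (L × L × K)`.
-/

open scoped LinearAlgebra.Projectivization

namespace ABB

/-- The line at infinity of PG(2, q^n): the points `(a, b, 0)`. -/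
def lineAtInfinity (L : Type*) [Field L] : Set (ℙ L (L × L × L)) :=
  {P | ∃ (a b : L) (h : ((a, b, 0) : L × L × L) ≠ 0), P = Projectivization.mk L (a, b, 0) h}

/-- The hyperplane at infinity of PG(2n, q): the points `(a, b, 0)`. -/
def hyperplaneAtInfinity (K L : Type*) [Field K] [Field L] [Algebra K L] :
    Set (ℙ K (L × L × K)) :=
  {Q | ∃ (a b : L) (h : ((a, b, 0) : L × L × K) ≠ 0), Q = Projectivization.mk K (a, b, 0) h}

/-- The subspread `D_k` of the hyperplane at infinity: the elements are the sets of points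
`{(a x, b x, 0) | x ∈ F, x ≠ 0}` with `(a, b) ≠ (0, 0)`, where `F` is the intermediate field
of degree `k` over `K`. -/
def subspread (K L : Type*) [Field K] [Field L] [Algebra K L] (k : ℕ) :
    Set (Set (ℙ K (L × L × K))) :=
  {E | ∃ F : IntermediateField K L, Module.finrank K F = k ∧
    ∃ a b : L, (a, b) ≠ (0, 0) ∧
      E = {Q | ∃ x ∈ F, ∃ h : ((a * x, b * x, 0) : L × L × K) ≠ 0,
        Q = Projectivization.mk K (a * x, b * x, 0) h}}

/-- The ABB-map. The image of an affine point `(a, b, 1)` is the point `(a, b, 1)` (as a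
singleton), the image of `(a, b, 0)` is the spread element `{(a x, b x, 0) | x ≠ 0}`. -/
def abbMap (K : Type*) {L : Type*} [Field K] [Field L] [Algebra K L]
    (P : ℙ L (L × L × L)) : Set (ℙ K (L × L × K)) :=
  {Q | (∃ (a b : L) (h : ((a, b, 1) : L × L × L) ≠ 0) (h' : ((a, b, 1) : L × L × K) ≠ 0),
      P = Projectivization.mk L (a, b, 1) h ∧ Q = Projectivization.mk K (a, b, 1) h') ∨
    (∃ (a b : L) (h : ((a, b, 0) : L × L × L) ≠ 0), P = Projectivization.mk L (a, b, 0) h ∧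
      ∃ (x : L) (h' : ((a * x, b * x, 0) : L × L × K) ≠ 0),
        Q = Projectivization.mk K (a * x, b * x, 0) h')}

/-- The ABB-image of a set of points of PG(2, q^n), as a set of points of PG(2n, q). -/
def abbImage (K : Type*) {L : Type*} [Field K] [Field L] [Algebra K L]
    (m : Set (ℙ L (L × L × L))) : Set (ℙ K (L × L × K)) :=
  ⋃ P ∈ m, abbMap K P

/-- `m` is an `𝔽_{q^k}`-subline of PG(2, q^n): for the intermediate field `F` of degree `k`
over `K` and two vectors `u`, `v` that are linearly independent over `L`, the set `m` consists
of the points `s u + t v` with `s, t ∈ F` not both zero. -/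
def IsSubline (K : Type*) {L : Type*} [Field K] [Field L] [Algebra K L] (k : ℕ)
    (m : Set (ℙ L (L × L × L))) : Prop :=
  ∃ F : IntermediateField K L, Module.finrank K F = k ∧
    ∃ u v : L × L × L, LinearIndependent L ![u, v] ∧
      m = {P | ∃ s ∈ F, ∃ t ∈ F, ∃ h : s • u + t • v ≠ 0,
        P = Projectivization.mk L (s • u + t • v) h}

/-- A set of points is external to the line at infinity if it is disjoint from it. -/
def IsExternal {L : Type*} [Field L] (m : Set (ℙ L (L × L × L))) : Prop :=
  Disjoint m (lineAtInfinity L)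

/-- A subline is tangent to the line at infinity if it has exactly one point on it. -/
def IsTangent {L : Type*} [Field L] (m : Set (ℙ L (L × L × L))) : Prop :=
  ∃! P, P ∈ m ∧ P ∈ lineAtInfinity L

/-- The smallest subline that contains `m` and is tangent to the line at infinity is an
`𝔽_{q^r}`-subline (smallest: over the smallest field). -/
def SmallestTangentDegree (K : Type*) {L : Type*} [Field K] [Field L] [Algebra K L]
    (m : Set (ℙ L (L × L × L))) (r : ℕ) : Prop :=
  (∃ m', IsSubline K r m' ∧ IsTangent m' ∧ m ⊆ m') ∧
    ∀ (s : ℕ) (m' : Set (ℙ L (L × L × L))),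
      IsSubline K s m' → IsTangent m' → m ⊆ m' → r ≤ s

/-- A normal rational curve of degree `d`, `2 ≤ d ≤ q`, in a projective space over `K`: the set
of points `∑ s ^ (d - i) t ^ i e_i`, `(s, t) ≠ (0, 0)`, for linearly independent
`e_0, …, e_d`. -/
def IsNormalRationalCurve {K V : Type*} [Field K] [AddCommGroup V] [Module K V] (d : ℕ)
    (C : Set (ℙ K V)) : Prop :=
  2 ≤ d ∧ d ≤ Nat.card K ∧ ∃ e : Fin (d + 1) → V, LinearIndependent K e ∧
    C = {Q | ∃ (s t : K) (h : ∑ i : Fin (d + 1), (s ^ (d - (i : ℕ)) * t ^ (i : ℕ)) • e i ≠ 0),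
      Q = Projectivization.mk K (∑ i : Fin (d + 1), (s ^ (d - (i : ℕ)) * t ^ (i : ℕ)) • e i) h}

end ABB

/-!
The inclusion `L × L × K → L × L × L` is semilinear, and the induced map from PG(2n, q) to
PG(2, q^n) inverts the ABB-map: ABB-images are preimages under it, and it is injective on affine
points.

Three points of a subline are `u`, `v` and `u + v` for suitable representatives, unique up to a
common factor; this gives the `𝔽_q`-subline through them. A linear relation over `𝔽_q` between
the corresponding points of PG(2n, q) produces a point of this subline at infinity, so three points
of the image of an external subline are not collinear.

On the line through `(p, 0)` at infinity and the affine point `(w, 1)`, the vectors of `L × L × K`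
form a copy of `L × K`. The affine points of the image of the `𝔽_{q^r}`-subline spanned by
`(p, 0)` and `(w, 1)` lie in `𝔽_{q^r} × K`, which has dimension `r + 1`.

An external `𝔽_q`-subline can be scaled to be spanned by `(p, 0) - x (w, 1)` and `(w, 1)` with
`x ∉ 𝔽_q`; its points other than `(w, 1)` then have coordinates `(1, t - x)`. With `f` the minimal
polynomial of `x` and `g = f / (X - x)`, multiplication by `g(t)` turns these into
`(g(t), f(t)) ∈ L × K`, a curve of degree `d = deg f` whose `d + 1` coefficient vectors are linearly
independent because the coefficients `g_0, …, g_{d-1}` form a basis of `𝔽_q(x)`.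
-/

namespace ABB

open Projectivization
open Submodule (span)

section LinearSet

variable {F L V : Type*} [Field F] [Field L] [AddCommGroup V] [Module F V] [Module L V]
  {u v : V} {P₁ P₂ P₃ : ℙ L V}

variable (L) in
/-- The `F`-linear set of an `F`-subspace `W` of an `L`-vector space: the points over `L` that are
spanned by a vector of `W`. The `F`-sublines are the linear sets of the spans of two vectors that
are linearly independent over `L`. -/
def linearSet (W : Submodule F V) : Set (ℙ L V) :=
  {P | ∃ w ∈ W, ∃ h : w ≠ 0, P = mk L w h}

/-- `u`, `v` is a frame for three points of a projective line: they are the points `u`, `v` and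
`u + v`. -/
structure IsFrame (P₁ P₂ P₃ : ℙ L V) (u v : V) : Prop where
  linearIndependent : LinearIndependent L ![u, v]
  submodule_fst : P₁.submodule = span L {u}
  submodule_snd : P₂.submodule = span L {v}
  submodule_thd : P₃.submodule = span L {u + v}

lemma linearIndependent_pair_of_mk_ne_mk (hu : u ≠ 0) (hv : v ≠ 0) (h : mk L u hu ≠ mk L v hv) :
    LinearIndependent L ![u, v] := by
  rwa [← independent_pair_iff_ne, independent_mk_iff_LinearIndependent] at h

lemma linearSet_mono {E : Type*} [Field E] [Module E V] {W : Submodule F V} {W' : Submodule E V}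
    (h : (W : Set V) ⊆ W') : linearSet L W ⊆ linearSet L W' := by
  rintro P ⟨w, hw, hw0, rfl⟩
  exact ⟨w, h hw, hw0, rfl⟩

lemma exists_eq_mk_of_submodule_eq_span_singleton {P : ℙ L V} (hP : P.submodule = span L {v}) :
    ∃ hv : v ≠ 0, P = mk L v hv := by
  have hv : v ≠ 0 := by
    rintro rfl
    have hrank := P.finrank_submodule
    rw [hP, Submodule.span_zero_singleton, finrank_bot] at hrank
    exact zero_ne_one hrank
  exact ⟨hv, submodule_injective (hP.trans (submodule_mk v hv).symm)⟩

lemma IsFrame.triple_subset (h : IsFrame P₁ P₂ P₃ u v) :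
    {P₁, P₂, P₃} ⊆ linearSet L (span F {u, v}) := by
  have hu : u ∈ span F {u, v} := Submodule.subset_span (by simp)
  have hv : v ∈ span F {u, v} := Submodule.subset_span (by simp)
  rintro P (rfl | rfl | rfl)
  · exact ⟨u, hu, exists_eq_mk_of_submodule_eq_span_singleton h.submodule_fst⟩
  · exact ⟨v, hv, exists_eq_mk_of_submodule_eq_span_singleton h.submodule_snd⟩
  · exact ⟨u + v, add_mem hu hv, exists_eq_mk_of_submodule_eq_span_singleton h.submodule_thd⟩

variable [Algebra F L] [IsScalarTower F L V]

lemma linearSet_span_smul_subset (c : L) (u v : V) :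
    linearSet L (span F {c • u, c • v}) ⊆ linearSet L (span F {u, v}) := by
  rintro P ⟨w, hw, hw0, rfl⟩
  obtain ⟨s, t, rfl⟩ := Submodule.mem_span_pair.1 hw
  have hst : s • c • u + t • c • v = c • (s • u + t • v) := by
    rw [smul_add, smul_comm c s, smul_comm c t]
  exact ⟨s • u + t • v, Submodule.mem_span_pair.2 ⟨s, t, rfl⟩,
    fun h => hw0 (by rw [hst, h, smul_zero]), (mk_eq_mk_iff' ..).2 ⟨c, hst.symm⟩⟩

lemma linearSet_span_smul {c : L} (hc : c ≠ 0) (u v : V) :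
    linearSet L (span F {c • u, c • v}) = linearSet L (span F {u, v}) := by
  refine (linearSet_span_smul_subset c u v).antisymm ?_
  simpa [smul_smul, hc] using linearSet_span_smul_subset (F := F) c⁻¹ (c • u) (c • v)

lemma span_pair_eq_of_mem {p q : V} (hpq : LinearIndependent L ![p, q])
    (hp : p ∈ span F {u, v}) (hq : q ∈ span F {u, v}) : span F {p, q} = span F {u, v} := by
  classical
  have : FiniteDimensional F (span F {u, v}) :=
    FiniteDimensional.span_of_finite F (Set.toFinite _)
  refine Submodule.eq_of_le_of_finrank_le (Submodule.span_le.2 (Set.pair_subset hp hq)) ?_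
  calc Module.finrank F (span F {u, v}) ≤ ({u, v} : Finset V).card := by
        have := finrank_span_finset_le_card (R := F) ({u, v} : Finset V)
        rwa [Finset.coe_pair] at this
    _ ≤ 2 := Finset.card_le_two
    _ = Module.finrank F (span F {p, q}) := by
        rw [← Matrix.range_cons_cons_empty p q ![]]
        simp [finrank_span_eq_card (hpq.restrict_scalars' F)]

lemma exists_isFrame (h₁ : P₁ ∈ linearSet L (span F {u, v})) (h₂ : P₂ ∈ linearSet L (span F {u, v}))
    (h₃ : P₃ ∈ linearSet L (span F {u, v})) (h₁₂ : P₁ ≠ P₂) (h₁₃ : P₁ ≠ P₃) (h₂₃ : P₂ ≠ P₃) :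
    ∃ u' v', IsFrame P₁ P₂ P₃ u' v' ∧ span F {u', v'} = span F {u, v} := by
  obtain ⟨p₁, hp₁, n₁, rfl⟩ := h₁
  obtain ⟨p₂, hp₂, n₂, rfl⟩ := h₂
  obtain ⟨p₃, hp₃, n₃, rfl⟩ := h₃
  have hspan := span_pair_eq_of_mem (linearIndependent_pair_of_mk_ne_mk n₁ n₂ h₁₂) hp₁ hp₂
  obtain ⟨x, y, rfl⟩ := Submodule.mem_span_pair.1 (hspan ▸ hp₃)
  have hx : x • p₁ ≠ 0 := fun hx =>
    h₂₃ ((mk_eq_mk_iff' ..).2 ⟨algebraMap F L y, by simp [hx]⟩).symm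
  have hy : y • p₂ ≠ 0 := fun hy =>
    h₁₃ ((mk_eq_mk_iff' ..).2 ⟨algebraMap F L x, by simp [hy]⟩).symm
  have e₁ : mk L (x • p₁) hx = mk L p₁ n₁ := (mk_eq_mk_iff' ..).2 ⟨algebraMap F L x, by simp⟩
  have e₂ : mk L (y • p₂) hy = mk L p₂ n₂ := (mk_eq_mk_iff' ..).2 ⟨algebraMap F L y, by simp⟩
  have hli : LinearIndependent L ![x • p₁, y • p₂] :=
    linearIndependent_pair_of_mk_ne_mk hx hy (by rwa [e₁, e₂])
  refine ⟨x • p₁, y • p₂, ⟨hli, ?_, ?_, submodule_mk ..⟩, span_pair_eq_of_mem hli ?_ ?_⟩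
  · rw [← e₁, submodule_mk]
  · rw [← e₂, submodule_mk]
  · exact Submodule.smul_mem _ x hp₁
  · exact Submodule.smul_mem _ y hp₂

lemma IsFrame.exists_smul_eq {u' v' : V} (h : IsFrame P₁ P₂ P₃ u v)
    (h' : IsFrame P₁ P₂ P₃ u' v') : ∃ c : L, c ≠ 0 ∧ u' = c • u ∧ v' = c • v := by
  obtain ⟨a, ha⟩ := Submodule.span_singleton_eq_span_singleton.1
    (h.submodule_fst.symm.trans h'.submodule_fst)
  obtain ⟨b, hb⟩ := Submodule.span_singleton_eq_span_singleton.1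
    (h.submodule_snd.symm.trans h'.submodule_snd)
  obtain ⟨c, hc⟩ := Submodule.span_singleton_eq_span_singleton.1
    (h.submodule_thd.symm.trans h'.submodule_thd)
  have hrel : (c - a : L) • u + (c - b : L) • v = 0 := by
    rw [← ha, ← hb] at hc
    simp only [Units.smul_def] at hc
    rw [sub_smul, sub_smul, ← sub_eq_zero.2 hc]
    module
  obtain ⟨hca, hcb⟩ := LinearIndependent.pair_iff.1 h.linearIndependent _ _ hrel
  refine ⟨c, c.ne_zero, ?_, ?_⟩
  · rw [sub_eq_zero.1 hca, ← ha, Units.smul_def]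
  · rw [sub_eq_zero.1 hcb, ← hb, Units.smul_def]

lemma linearSet_span_pair_eq_of_three_mem {u' v' : V}
    (h : ({P₁, P₂, P₃} : Set (ℙ L V)) ⊆ linearSet L (span F {u, v}))
    (h' : ({P₁, P₂, P₃} : Set (ℙ L V)) ⊆ linearSet L (span F {u', v'}))
    (h₁₂ : P₁ ≠ P₂) (h₁₃ : P₁ ≠ P₃) (h₂₃ : P₂ ≠ P₃) :
    linearSet L (span F {u', v'}) = linearSet L (span F {u, v}) := by
  obtain ⟨a, b, hab, hspan⟩ :=
    exists_isFrame (h (by simp)) (h (by simp)) (h (by simp)) h₁₂ h₁₃ h₂₃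
  obtain ⟨a', b', hab', hspan'⟩ :=
    exists_isFrame (h' (by simp)) (h' (by simp)) (h' (by simp)) h₁₂ h₁₃ h₂₃
  obtain ⟨c, hc, rfl, rfl⟩ := hab.exists_smul_eq hab'
  rw [← hspan, ← hspan', linearSet_span_smul hc]

/-- The semilinear parametrization `(s, t) ↦ s u + t v` of the span of `u` and `v`. -/
def pairCombination (u v : V) : F × F →ₛₗ[algebraMap F L] V where
  toFun z := z.1 • u + z.2 • v
  map_add' z z' := by simp only [Prod.fst_add, Prod.snd_add]; module
  map_smul' c z := by simp only [Prod.smul_fst, Prod.smul_snd, algebraMap_smul]; module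

lemma pairCombination_apply (u v : V) (z : F × F) :
    pairCombination (L := L) u v z = z.1 • u + z.2 • v := rfl

lemma pairCombination_injective (huv : LinearIndependent L ![u, v]) :
    Function.Injective (pairCombination (F := F) (L := L) u v) := fun _ _ hz =>
  Prod.ext_iff.2 ((huv.restrict_scalars' F).eq_of_pair hz)

lemma linearSet_span_pair_eq_range (huv : LinearIndependent L ![u, v]) :
    linearSet L (span F {u, v}) =
      Set.range (Projectivization.map _ (pairCombination_injective (F := F) huv)) := by
  ext P
  constructor
  · rintro ⟨w, hw, hw0, rfl⟩
    obtain ⟨s, t, rfl⟩ := Submodule.mem_span_pair.1 hw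
    exact ⟨mk F (s, t) fun h => hw0 (by simp_all), rfl⟩
  · rintro ⟨Q, rfl⟩
    induction Q using Projectivization.ind with | h z hz => ?_
    exact ⟨_, Submodule.mem_span_pair.2 ⟨z.1, z.2, rfl⟩, _, map_mk ..⟩

lemma map_pairCombination_injective (huv : LinearIndependent L ![u, v]) :
    Function.Injective (Projectivization.map _ (pairCombination_injective (F := F) huv)) := by
  intro P Q h
  induction P using Projectivization.ind with | h z hz => ?_
  induction Q using Projectivization.ind with | h z' hz' => ?_
  obtain ⟨a, ha⟩ := (mk_eq_mk_iff' ..).1 h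
  obtain ⟨h₁, h₂⟩ : a * algebraMap F L z'.1 = algebraMap F L z.1 ∧
      a * algebraMap F L z'.2 = algebraMap F L z.2 := by
    refine huv.eq_of_pair ?_
    simpa [pairCombination_apply, mul_smul, smul_add] using ha
  obtain ⟨c, rfl⟩ : ∃ c, algebraMap F L c = a := by
    by_cases h0 : z'.1 = 0
    · have : z'.2 ≠ 0 := fun h0' => hz' (Prod.ext h0 h0')
      exact ⟨z.2 / z'.2, by rw [map_div₀, div_eq_iff (by simpa using this), h₂]⟩
    · exact ⟨z.1 / z'.1, by rw [map_div₀, div_eq_iff (by simpa using h0), h₁]⟩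
  refine (mk_eq_mk_iff' ..).2 ⟨c, pairCombination_injective huv ?_⟩
  rw [map_smulₛₗ, ha]

lemma ncard_linearSet_span_pair [Finite F] (huv : LinearIndependent L ![u, v]) :
    (linearSet L (span F {u, v})).ncard = Nat.card F + 1 := by
  rw [linearSet_span_pair_eq_range huv,
    Set.ncard_range_of_injective (map_pairCombination_injective huv),
    card_of_finrank_two F (F × F) (by simp)]

end LinearSet

section ABBMap

variable (K L : Type*) [Field K] [Field L] [Algebra K L]

/-- The inclusion `(a, b, c) ↦ (a, b, c)` of the vector space underlying `PG(2n, q)` into the one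
underlying `PG(2, q^n)`. -/
def planeVec : L × L × K →ₛₗ[algebraMap K L] L × L × L where
  toFun p := (p.1, p.2.1, algebraMap K L p.2.2)
  map_add' p p' := by simp
  map_smul' c p := by simp [Algebra.smul_def]

lemma planeVec_injective : Function.Injective (planeVec K L) := by
  rintro ⟨a, b, c⟩ ⟨a', b', c'⟩ h
  simpa [planeVec] using h

/-- The inverse of the ABB-map: a point `Q` of `PG(2n, q)` lies in the ABB-image of the point
`toPlane K L Q` of `PG(2, q^n)` and of no other. -/
def toPlane : ℙ K (L × L × K) → ℙ L (L × L × L) :=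
  Projectivization.map (planeVec K L) (planeVec_injective K L)

variable {K L}

lemma planeVec_ne_zero {q : L × L × K} (hq : q ≠ 0) : planeVec K L q ≠ 0 :=
  (map_ne_zero_iff _ (planeVec_injective K L)).2 hq

lemma mk_mem_lineAtInfinity_iff {p : L × L × L} (hp : p ≠ 0) :
    mk L p hp ∈ lineAtInfinity L ↔ p.2.2 = 0 := by
  constructor
  · rintro ⟨a, b, h, hP⟩
    obtain ⟨c, rfl⟩ := (mk_eq_mk_iff' ..).1 hP
    simp
  · intro h
    obtain ⟨a, b, c⟩ := p
    obtain rfl : c = 0 := h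
    exact ⟨a, b, hp, rfl⟩

lemma mk_mem_hyperplaneAtInfinity_iff {q : L × L × K} (hq : q ≠ 0) :
    mk K q hq ∈ hyperplaneAtInfinity K L ↔ q.2.2 = 0 := by
  constructor
  · rintro ⟨a, b, h, hQ⟩
    obtain ⟨c, rfl⟩ := (mk_eq_mk_iff' ..).1 hQ
    simp
  · intro h
    obtain ⟨a, b, c⟩ := q
    obtain rfl : c = 0 := h
    exact ⟨a, b, hq, rfl⟩

lemma toPlane_mem_lineAtInfinity_iff {Q : ℙ K (L × L × K)} :
    toPlane K L Q ∈ lineAtInfinity L ↔ Q ∈ hyperplaneAtInfinity K L := by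
  induction Q using Projectivization.ind with | h q hq => ?_
  rw [mk_mem_hyperplaneAtInfinity_iff, toPlane, map_mk, mk_mem_lineAtInfinity_iff]
  exact map_eq_zero (algebraMap K L)

lemma mem_abbMap_iff {P : ℙ L (L × L × L)} {Q : ℙ K (L × L × K)} :
    Q ∈ abbMap K P ↔ toPlane K L Q = P := by
  constructor
  · rintro (⟨a, b, h, h', rfl, rfl⟩ | ⟨a, b, h, rfl, x, h', rfl⟩)
    · exact (mk_eq_mk_iff' ..).2 ⟨1, by simp [planeVec]⟩
    · exact (mk_eq_mk_iff' ..).2 ⟨x, by simp [planeVec, mul_comm x]⟩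
  · rintro rfl
    induction Q using Projectivization.ind with | h q hq => ?_
    obtain ⟨a, b, c⟩ := q
    by_cases hc : c = 0
    · subst hc
      exact Or.inr ⟨a, b, by simpa using hq, (mk_eq_mk_iff' ..).2 ⟨1, by simp [planeVec]⟩,
        1, by simpa using hq, by simp⟩
    · exact Or.inl ⟨c⁻¹ • a, c⁻¹ • b, by simp, by simp,
        (mk_eq_mk_iff' ..).2 ⟨algebraMap K L c, by simp [planeVec, hc, Algebra.smul_def]⟩,
        (mk_eq_mk_iff' ..).2 ⟨c, by simp [hc]⟩⟩

lemma abbImage_eq_preimage (m : Set (ℙ L (L × L × L))) :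
    abbImage K m = toPlane K L ⁻¹' m := by
  ext Q
  simp [abbImage, mem_abbMap_iff]

lemma injOn_toPlane : Set.InjOn (toPlane K L) (hyperplaneAtInfinity K L)ᶜ := by
  intro Q hQ Q' hQ' h
  induction Q using Projectivization.ind with | h q hq => ?_
  induction Q' using Projectivization.ind with | h q' hq' => ?_
  rw [Set.mem_compl_iff, mk_mem_hyperplaneAtInfinity_iff] at hQ'
  obtain ⟨a, ha⟩ := (mk_eq_mk_iff' ..).1 h
  obtain ⟨c, rfl⟩ : ∃ c, algebraMap K L c = a := by
    refine ⟨q.2.2 / q'.2.2, ?_⟩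
    rw [map_div₀, div_eq_iff (by simpa using hQ')]
    exact (congrArg (·.2.2) ha).symm
  exact (mk_eq_mk_iff' ..).2 ⟨c, planeVec_injective K L (by rw [map_smulₛₗ, ha])⟩

lemma exists_toPlane_eq {P : ℙ L (L × L × L)} (hP : P ∉ lineAtInfinity L) :
    ∃ Q, toPlane K L Q = P := by
  induction P using Projectivization.ind with | h p hp => ?_
  rw [mk_mem_lineAtInfinity_iff] at hP
  refine ⟨mk K (p.1 / p.2.2, p.2.1 / p.2.2, 1) (by simp), ?_⟩
  refine (mk_eq_mk_iff' ..).2 ⟨p.2.2⁻¹, ?_⟩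
  ext <;> simp [planeVec, hP, div_eq_inv_mul]

lemma IsExternal.mono {m m' : Set (ℙ L (L × L × L))} (hm : IsExternal m) (h : m' ⊆ m) :
    IsExternal m' :=
  Set.disjoint_of_subset_left h hm

variable {m : Set (ℙ L (L × L × L))}

lemma IsExternal.disjoint_abbImage (hm : IsExternal m) :
    Disjoint (abbImage K m) (hyperplaneAtInfinity K L) := by
  rw [Set.disjoint_left, abbImage_eq_preimage]
  intro Q hQ hQinf
  exact Set.disjoint_left.1 hm hQ (toPlane_mem_lineAtInfinity_iff.2 hQinf)

lemma IsExternal.ncard_abbImage (hm : IsExternal m) : (abbImage K m).ncard = m.ncard := by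
  have himage : toPlane K L '' abbImage K m = m := by
    rw [abbImage_eq_preimage, Set.image_preimage_eq_of_subset]
    exact fun P hP => exists_toPlane_eq (Set.disjoint_left.1 hm hP)
  rw [← (injOn_toPlane.mono hm.disjoint_abbImage.subset_compl_right).ncard_image, himage]

lemma isSubline_iff {k : ℕ} :
    IsSubline K k m ↔ ∃ F : IntermediateField K L, Module.finrank K F = k ∧
      ∃ u v, LinearIndependent L ![u, v] ∧ m = linearSet L (span F {u, v}) := by
  have h (F : IntermediateField K L) (u v : L × L × L) :
      {P | ∃ s ∈ F, ∃ t ∈ F, ∃ h : s • u + t • v ≠ 0, P = mk L (s • u + t • v) h} =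
        linearSet L (span F {u, v}) := by
    ext P
    constructor
    · rintro ⟨s, hs, t, ht, h, rfl⟩
      exact ⟨_, Submodule.mem_span_pair.2 ⟨⟨s, hs⟩, ⟨t, ht⟩, rfl⟩, h, rfl⟩
    · rintro ⟨w, hw, h, rfl⟩
      obtain ⟨s, t, rfl⟩ := Submodule.mem_span_pair.1 hw
      exact ⟨s, s.2, t, t.2, h, rfl⟩
  simp only [IsSubline, h]

lemma isSubline_one_iff :
    IsSubline K 1 m ↔
      ∃ u v, LinearIndependent L ![u, v] ∧ m = linearSet L (span K {u, v}) := by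
  have h (u v : L × L × L) : linearSet L (span (⊥ : IntermediateField K L) {u, v}) =
      linearSet L (span K {u, v}) := by
    refine (linearSet_mono fun w hw => ?_).antisymm
      (linearSet_mono (Submodule.span_le_restrictScalars ..))
    obtain ⟨⟨s, hs⟩, ⟨t, ht⟩, rfl⟩ := Submodule.mem_span_pair.1 hw
    obtain ⟨s, rfl⟩ := IntermediateField.mem_bot.1 hs
    obtain ⟨t, rfl⟩ := IntermediateField.mem_bot.1 ht
    exact Submodule.mem_span_pair.2 ⟨s, t,
      congrArg₂ (· + ·) (algebraMap_smul L s u).symm (algebraMap_smul L t v).symm⟩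
  simp only [isSubline_iff, IntermediateField.finrank_eq_one_iff, exists_eq_left, h]

end ABBMap

section Collinear

variable {K L V : Type*} [Field K] [Field L] [Algebra K L] [AddCommGroup V] [Module K V]

lemma not_isCollinear_of_linearIndependent {x y z : V} (h : LinearIndependent K ![x, y, z])
    (hx : x ≠ 0) (hy : y ≠ 0) (hz : z ≠ 0) :
    ¬ IsCollinear {mk K x hx, mk K y hy, mk K z hz} := by
  rintro ⟨M, _, hrank, hM⟩
  have hle : span K (Set.range ![x, y, z]) ≤ M.submodule := by
    rw [Submodule.span_le, Set.range_subset_iff, Fin.forall_fin_succ, Fin.forall_fin_two]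
    exact ⟨(M.mem_submodule_iff hx).2 (hM (by simp)), (M.mem_submodule_iff hy).2 (hM (by simp)),
      (M.mem_submodule_iff hz).2 (hM (by simp))⟩
  have := (Submodule.finrank_mono hle).trans hrank
  rw [finrank_span_eq_card h, Fintype.card_fin] at this
  omega

lemma IsExternal.eq_zero_of_snd_snd_eq_zero {u v : L × L × L} (huv : LinearIndependent L ![u, v])
    (hext : IsExternal (linearSet L (span K {u, v}))) {s t : K}
    (h : (s • u + t • v).2.2 = 0) : s = 0 ∧ t = 0 := by
  refine LinearIndependent.pair_iff.1 (huv.restrict_scalars' K) s t ?_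
  by_contra h0
  exact Set.disjoint_left.1 hext ⟨_, Submodule.mem_span_pair.2 ⟨s, t, rfl⟩, h0, rfl⟩
    ((mk_mem_lineAtInfinity_iff h0).2 h)

lemma IsFrame.not_isCollinear {X Y Z : ℙ K (L × L × K)} {u v : L × L × L}
    (h : IsFrame (toPlane K L X) (toPlane K L Y) (toPlane K L Z) u v)
    (hext : IsExternal (linearSet L (span K {u, v}))) : ¬ IsCollinear {X, Y, Z} := by
  obtain ⟨huv, hX, hY, hZ⟩ := h
  induction X using Projectivization.ind with | h x hx => ?_
  induction Y using Projectivization.ind with | h y hy => ?_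
  induction Z using Projectivization.ind with | h z hz => ?_
  simp only [toPlane, map_mk, submodule_mk] at hX hY hZ
  obtain ⟨a, ha⟩ := Submodule.span_singleton_eq_span_singleton.1 hX.symm
  obtain ⟨b, hb⟩ := Submodule.span_singleton_eq_span_singleton.1 hY.symm
  obtain ⟨c, hc⟩ := Submodule.span_singleton_eq_span_singleton.1 hZ.symm
  have hx₃ : algebraMap K L x.2.2 = a * u.2.2 := congrArg (·.2.2) ha.symm
  have hy₃ : algebraMap K L y.2.2 = b * v.2.2 := congrArg (·.2.2) hb.symm
  have hu₃ : u.2.2 ≠ 0 := fun hu => one_ne_zero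
    (hext.eq_zero_of_snd_snd_eq_zero huv (s := 1) (t := 0) (by simpa using hu)).1
  have hv₃ : v.2.2 ≠ 0 := fun hv => one_ne_zero
    (hext.eq_zero_of_snd_snd_eq_zero huv (s := 0) (t := 1) (by simpa using hv)).2
  refine not_isCollinear_of_linearIndependent
    (Fintype.linearIndependent_iff.2 fun d hd => ?_) hx hy hz
  have hrel : (algebraMap K L (d 0) * a + algebraMap K L (d 2) * c) • u +
      (algebraMap K L (d 1) * b + algebraMap K L (d 2) * c) • v = 0 := by
    have := congrArg (planeVec K L) hd
    simp only [Fin.sum_univ_three, Matrix.cons_val, map_add, map_smulₛₗ, ← ha, ← hb, ← hc,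
      map_zero, Units.smul_def] at this
    rw [← this]
    module
  obtain ⟨hac, hbc⟩ := LinearIndependent.pair_iff.1 huv _ _ hrel
  have hinf : ((d 1 * y.2.2) • u + (-(d 0 * x.2.2)) • v).2.2 = 0 := by
    simp only [Prod.snd_add, Prod.smul_snd]
    simp only [Algebra.smul_def, map_neg, map_mul, hx₃, hy₃]
    linear_combination u.2.2 * v.2.2 * (hbc - hac)
  obtain ⟨hd₁, hd₀⟩ := hext.eq_zero_of_snd_snd_eq_zero huv hinf
  have hy₀ : y.2.2 ≠ 0 := (map_ne_zero (algebraMap K L)).1 (hy₃ ▸ mul_ne_zero b.ne_zero hv₃)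
  have hx₀ : x.2.2 ≠ 0 := (map_ne_zero (algebraMap K L)).1 (hx₃ ▸ mul_ne_zero a.ne_zero hu₃)
  have hd₀ : d 0 = 0 := by simpa [hx₀] using hd₀
  have hd₁ : d 1 = 0 := by simpa [hy₀] using hd₁
  have hd₂ : d 2 = 0 := by simpa [hd₀] using hac
  rw [Fin.forall_fin_succ, Fin.forall_fin_two]
  exact ⟨hd₀, hd₁, hd₂⟩

end Collinear

section LineChart

variable {K L : Type*} [Field K] [Field L] [Algebra K L] {p w : L × L}

/-- The `K`-linear coordinates `(x, c) ↦ (x p + c w, c)` on the vectors of `L × L × K` that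
represent a point of the line of `PG(2, q^n)` through the point `(p, 0)` at infinity and the affine
point `(w, 1)`. -/
def lineChart (p w : L × L) : L × K →ₗ[K] L × L × K where
  toFun z := (p.1 * z.1 + z.2 • w.1, p.2 * z.1 + z.2 • w.2, z.2)
  map_add' z z' := by ext <;> simp only [Prod.fst_add, Prod.snd_add, add_smul] <;> ring
  map_smul' c z := by ext <;> simp [mul_smul, smul_add]

lemma lineChart_apply (z : L × K) :
    lineChart p w z = (p.1 * z.1 + z.2 • w.1, p.2 * z.1 + z.2 • w.2, z.2) := rfl

lemma planeVec_lineChart (z : L × K) :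
    planeVec K L (lineChart p w z) =
      z.1 • (p.1, p.2, (0 : L)) + algebraMap K L z.2 • (w.1, w.2, (1 : L)) := by
  ext <;> simp [planeVec, lineChart_apply, Algebra.smul_def, mul_comm]

lemma lineChart_injective (hp : p ≠ 0) :
    Function.Injective (lineChart (K := K) p w) := by
  rw [← LinearMap.ker_eq_bot, LinearMap.ker_eq_bot']
  rintro ⟨x, c⟩ h
  obtain ⟨h₁, h₂, rfl⟩ : p.1 * x + c • w.1 = 0 ∧ p.2 * x + c • w.2 = 0 ∧ c = 0 := by
    simpa [lineChart_apply] using h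
  by_contra hx
  refine hp (Prod.ext ?_ ?_) <;> simp_all

/-- The vectors of `L × L × K` whose coordinates on the line through `(p, 0)` and `(w, 1)` lie in
`F × K`. -/
def lineSubspace (F : IntermediateField K L) (p w : L × L) : Submodule K (L × L × K) :=
  LinearMap.range (lineChart p w ∘ₗ F.val.toLinearMap.prodMap LinearMap.id)

lemma mem_lineSubspace_iff {F : IntermediateField K L} {q : L × L × K} :
    q ∈ lineSubspace F p w ↔ ∃ x ∈ F, ∃ c : K, lineChart p w (x, c) = q :=
  ⟨fun ⟨⟨x, c⟩, h⟩ => ⟨x, x.2, c, h⟩, fun ⟨x, hx, c, h⟩ => ⟨(⟨x, hx⟩, c), h⟩⟩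

lemma finrank_lineSubspace [FiniteDimensional K L] (F : IntermediateField K L) (hp : p ≠ 0) :
    Module.finrank K (lineSubspace F p w) = Module.finrank K F + 1 := by
  have hinj : Function.Injective
      (lineChart (K := K) p w ∘ₗ F.val.toLinearMap.prodMap LinearMap.id) :=
    (lineChart_injective hp).comp (F.val.injective.prodMap Function.injective_id)
  rw [lineSubspace, LinearMap.finrank_range_of_inj hinj, Module.finrank_prod, Module.finrank_self]

lemma lineSubspace_inter_hyperplaneAtInfinity (F : IntermediateField K L) (p w : L × L) :
    ((lineSubspace F p w).projectivization : Set (ℙ K (L × L × K))) ∩ hyperplaneAtInfinity K L =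
      {Q | ∃ x ∈ F, ∃ h : ((p.1 * x, p.2 * x, 0) : L × L × K) ≠ 0,
        Q = mk K (p.1 * x, p.2 * x, 0) h} := by
  ext Q
  constructor
  · rintro ⟨hW, hinf⟩
    induction Q using Projectivization.ind with | h q hq => ?_
    obtain ⟨x, hx, c, rfl⟩ :=
      mem_lineSubspace_iff.1 ((Submodule.mk_mem_projectivization_iff ..).1 hW)
    obtain rfl : c = 0 := (mk_mem_hyperplaneAtInfinity_iff hq).1 hinf
    exact ⟨x, hx, by simpa [lineChart_apply] using hq, by simp [lineChart_apply]⟩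
  · rintro ⟨x, hx, h, rfl⟩
    refine ⟨(Submodule.mk_mem_projectivization_iff ..).2 (mem_lineSubspace_iff.2 ⟨x, hx, 0, ?_⟩),
      (mk_mem_hyperplaneAtInfinity_iff h).2 rfl⟩
    simp [lineChart_apply]

lemma abbImage_linearSet_diff_subset (F : IntermediateField K L) (p w : L × L) :
    abbImage K (linearSet L (span F {(p.1, p.2, (0 : L)), (w.1, w.2, (1 : L))})) \
      hyperplaneAtInfinity K L ⊆ (lineSubspace F p w).projectivization := by
  rintro Q ⟨hQ, hinf⟩
  rw [abbImage_eq_preimage] at hQ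
  induction Q using Projectivization.ind with | h q hq => ?_
  rw [mk_mem_hyperplaneAtInfinity_iff] at hinf
  obtain ⟨y, hy, hy0, hyq⟩ := hQ
  obtain ⟨s, t, rfl⟩ := Submodule.mem_span_pair.1 hy
  obtain ⟨a, ha⟩ := (mk_eq_mk_iff' ..).1 hyq
  have hat : a * t = algebraMap K L q.2.2 := by
    have h₃ : a * (s * 0 + t * 1) = algebraMap K L q.2.2 := congrArg (·.2.2) ha
    simpa using h₃
  have ht : (t : L) ≠ 0 := right_ne_zero_of_mul (hat ▸ (map_ne_zero _).2 hinf)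
  have haF : a ∈ F := by
    rw [eq_div_of_mul_eq ht hat]
    exact F.div_mem (F.algebraMap_mem _) t.2
  refine (Submodule.mk_mem_projectivization_iff ..).2
    (mem_lineSubspace_iff.2 ⟨a * s, F.mul_mem haF s.2, q.2.2, planeVec_injective K L ?_⟩)
  rw [planeVec_lineChart, ← hat, mul_smul, mul_smul, ← smul_add]
  exact ha

lemma exists_linearSet_eq_of_mem_lineAtInfinity {F : Type*} [Field F] [Algebra F L]
    {u v : L × L × L} {P Q : ℙ L (L × L × L)} (hP : P ∈ linearSet L (span F {u, v}))
    (hQ : Q ∈ linearSet L (span F {u, v})) (hPinf : P ∈ lineAtInfinity L)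
    (hQinf : Q ∉ lineAtInfinity L) :
    ∃ p w : L × L, p ≠ 0 ∧ linearSet L (span F {u, v}) =
      linearSet L (span F {(p.1, p.2, (0 : L)), (w.1, w.2, (1 : L))}) := by
  have hne : P ≠ Q := fun h => hQinf (h ▸ hPinf)
  obtain ⟨⟨a, b, c⟩, hp, hp0, rfl⟩ := hP
  obtain ⟨⟨a', b', c'⟩, hq, hq0, rfl⟩ := hQ
  obtain rfl : c = 0 := (mk_mem_lineAtInfinity_iff hp0).1 hPinf
  have hc' : c' ≠ 0 := fun h => hQinf ((mk_mem_lineAtInfinity_iff hq0).2 h)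
  refine ⟨c'⁻¹ • (a, b), c'⁻¹ • (a', b'), by simpa [hc'] using hp0, ?_⟩
  rw [← span_pair_eq_of_mem (linearIndependent_pair_of_mk_ne_mk hp0 hq0 hne) hp hq,
    ← linearSet_span_smul (inv_ne_zero hc')]
  simp [hc']

lemma IsSubline.exists_subspace [FiniteDimensional K L] {r : ℕ} {m : Set (ℙ L (L × L × L))}
    (hm : IsSubline K r m) (hinf : ¬ IsExternal m) (haff : ¬ m ⊆ lineAtInfinity L) :
    ∃ W : Projectivization.Subspace K (L × L × K), Module.finrank K W.submodule = r + 1 ∧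
      abbImage K m \ hyperplaneAtInfinity K L ⊆ W ∧
      (W : Set (ℙ K (L × L × K))) ∩ hyperplaneAtInfinity K L ∈ subspread K L r := by
  obtain ⟨F, rfl, u, v, -, rfl⟩ := isSubline_iff.1 hm
  obtain ⟨P, hP, hPinf⟩ := Set.not_disjoint_iff.1 hinf
  obtain ⟨Q, hQ, hQinf⟩ := Set.not_subset.1 haff
  obtain ⟨p, w, hp, heq⟩ := exists_linearSet_eq_of_mem_lineAtInfinity hP hQ hPinf hQinf
  refine ⟨(lineSubspace F p w).projectivization, ?_, heq ▸ abbImage_linearSet_diff_subset F p w,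
    F, rfl, p.1, p.2, hp, lineSubspace_inter_hyperplaneAtInfinity F p w⟩
  rw [← finrank_lineSubspace F hp, OrderIso.apply_symm_apply]

end LineChart

section RationalCurve

open Polynomial

variable {K L : Type*} [Field K] [Field L] [Algebra K L] {x : L}

lemma linearIndependent_prodMk_fin_succ {V : Type*} [AddCommGroup V] [Module K V] {n : ℕ}
    {a : Fin (n + 1) → V} {b : Fin (n + 1) → K}
    (ha : LinearIndependent K fun i : Fin n => a i.castSucc) (ha₀ : a (Fin.last n) = 0)
    (hb : b (Fin.last n) ≠ 0) : LinearIndependent K fun i => (a i, b i) := by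
  rw [Fintype.linearIndependent_iff]
  intro c hc
  obtain ⟨h₁, h₂⟩ : ∑ i, c i • a i = 0 ∧ ∑ i, c i • b i = 0 := by
    simpa only [Prod.ext_iff, Prod.fst_sum, Prod.snd_sum, Prod.smul_mk, Prod.fst_zero,
      Prod.snd_zero] using hc
  simp only [Fin.sum_univ_castSucc, ha₀, smul_zero, add_zero] at h₁
  have hinit : ∀ i : Fin n, c i.castSucc = 0 := Fintype.linearIndependent_iff.1 ha _ h₁
  have hlast : c (Fin.last n) = 0 := by simpa [Fin.sum_univ_castSucc, hinit, hb] using h₂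
  exact Fin.lastCases hlast hinit

lemma linearIndependent_coeff_minpolyDiv (hx : IsIntegral K x) :
    LinearIndependent K
      (fun i : Fin (minpoly K x).natDegree => (minpolyDiv K x).coeff i) := by
  have hspan : span K (Set.range fun i : Fin (minpoly K x).natDegree => (minpolyDiv K x).coeff i) =
      Subalgebra.toSubmodule (Algebra.adjoin K {x}) := by
    rw [← span_coeff_minpolyDiv hx]
    refine le_antisymm (Submodule.span_mono ?_) (Submodule.span_le.2 ?_)
    · rintro _ ⟨i, rfl⟩
      exact ⟨i, rfl⟩
    · rintro _ ⟨i, rfl⟩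
      by_cases hi : i < (minpoly K x).natDegree
      · exact Submodule.subset_span ⟨⟨i, hi⟩, rfl⟩
      · rw [coeff_eq_zero_of_natDegree_lt ((natDegree_minpolyDiv_lt hx).trans_le (not_lt.1 hi))]
        exact zero_mem _
  rw [linearIndependent_iff_card_eq_finrank_span, Fintype.card_fin, Set.finrank, hspan,
    Subalgebra.finrank_toSubmodule,
    ← IntermediateField.adjoin_simple_toSubalgebra_of_isAlgebraic hx.isAlgebraic]
  exact (IntermediateField.adjoin.finrank hx).symm

/-- The coefficient vectors of the rational curve through the points `(1, t - x)`, `t ∈ K`, of the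
projective line over `L`, rescaled so as to lie in `L × K`: the polynomial vector
`(minpolyDiv K x, minpoly K x)` is `minpolyDiv K x • (1, X - x)`. -/
noncomputable def curveCoeff (K : Type*) {L : Type*} [Field K] [Field L] [Algebra K L] (x : L)
    (i : Fin ((minpoly K x).natDegree + 1)) : L × K :=
  ((minpolyDiv K x).coeff i, (minpoly K x).coeff i)

lemma linearIndependent_curveCoeff (hx : IsIntegral K x) :
    LinearIndependent K (curveCoeff K x) := by
  refine linearIndependent_prodMk_fin_succ (linearIndependent_coeff_minpolyDiv hx)
    (coeff_eq_zero_of_natDegree_lt (natDegree_minpolyDiv_lt hx)) ?_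
  rw [Fin.val_last, coeff_natDegree, (minpoly.monic hx).leadingCoeff]
  exact one_ne_zero

lemma exists_sum_smul_curveCoeff_eq (hx : IsIntegral K x) (s t : K) :
    ∃ (G : L) (c : K), algebraMap K L c = G * (algebraMap K L t - s • x) ∧
      ∑ i : Fin ((minpoly K x).natDegree + 1),
        (s ^ ((minpoly K x).natDegree - (i : ℕ)) * t ^ (i : ℕ)) • curveCoeff K x i =
          (s • G, c) := by
  set d := (minpoly K x).natDegree
  set f := minpoly K x
  set g := minpolyDiv K x
  set G := ∑ i ∈ Finset.range d, (s ^ (d - (i + 1)) * t ^ i) • g.coeff i with hG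
  have hg : ∑ i ∈ Finset.range (d + 1), (s ^ (d - i) * t ^ i) • g.coeff i = s • G := by
    rw [Finset.sum_range_succ, coeff_eq_zero_of_natDegree_lt (natDegree_minpolyDiv_lt hx),
      smul_zero, add_zero, hG, Finset.smul_sum]
    refine Finset.sum_congr rfl fun i hi => ?_
    rw [smul_smul, ← mul_assoc, ← pow_succ', Nat.sub_add_eq,
      Nat.sub_add_cancel (Nat.sub_pos_of_lt (Finset.mem_range.1 hi))]
  have htG : t • G = ∑ i ∈ Finset.range d, (s ^ (d - (i + 1)) * t ^ (i + 1)) • g.coeff i := by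
    rw [hG, Finset.smul_sum]
    exact Finset.sum_congr rfl fun i _ => by rw [smul_smul]; ring_nf
  have hf₀ : algebraMap K L (f.coeff 0) = -(g.coeff 0 * x) := by
    rw [← coeff_map, ← minpolyDiv_spec K x]
    simp [g, mul_coeff_zero]
  have hf (i : ℕ) : algebraMap K L (f.coeff (i + 1)) = g.coeff i - g.coeff (i + 1) * x :=
    eq_sub_of_add_eq (coeff_minpolyDiv K x i).symm
  refine ⟨G, ∑ i ∈ Finset.range (d + 1), (s ^ (d - i) * t ^ i) • f.coeff i, ?_, ?_⟩
  · calc algebraMap K L (∑ i ∈ Finset.range (d + 1), (s ^ (d - i) * t ^ i) • f.coeff i)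
        = ∑ i ∈ Finset.range (d + 1), (s ^ (d - i) * t ^ i) • algebraMap K L (f.coeff i) := by
          simp only [map_sum, smul_eq_mul, map_mul, Algebra.smul_def]
      _ = t • G - (∑ i ∈ Finset.range (d + 1), (s ^ (d - i) * t ^ i) • g.coeff i) * x := by
          rw [htG, Finset.sum_range_succ', Finset.sum_range_succ' (fun i => _ • g.coeff i)]
          simp only [hf, hf₀, smul_sub, Finset.sum_sub_distrib, add_mul, Finset.sum_mul,
            smul_mul_assoc, smul_neg]
          abel
      _ = G * (algebraMap K L t - s • x) := by
          rw [hg, Algebra.smul_def, Algebra.smul_def, Algebra.smul_def]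
          ring
  · rw [← hg]
    ext
    · simp only [curveCoeff, Prod.fst_sum, Prod.smul_fst]
      exact Fin.sum_univ_eq_sum_range (fun i => (s ^ (d - i) * t ^ i) • g.coeff i) _
    · simp only [curveCoeff, Prod.snd_sum, Prod.smul_snd]
      exact Fin.sum_univ_eq_sum_range (fun i => (s ^ (d - i) * t ^ i) • f.coeff i) _

variable {p w : L × L}

lemma isExternal_linearSet_of_notMem_range (hx : x ∉ (algebraMap K L).range) :
    IsExternal (linearSet L
      (span K {(p.1, p.2, (0 : L)) - x • (w.1, w.2, (1 : L)), (w.1, w.2, (1 : L))})) := by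
  refine Set.disjoint_left.2 ?_
  rintro P ⟨y, hy, hy0, rfl⟩ hinf
  obtain ⟨s, t, rfl⟩ := Submodule.mem_span_pair.1 hy
  have hst : algebraMap K L s * x = algebraMap K L t := by
    simpa [Algebra.smul_def, neg_add_eq_zero] using (mk_mem_lineAtInfinity_iff hy0).1 hinf
  have hs : s = 0 := by
    by_contra hs
    refine hx ⟨t / s, ?_⟩
    rw [map_div₀, ← hst, mul_div_cancel_left₀ _ ((_root_.map_ne_zero _).2 hs)]
  have ht : t = 0 := by simpa [hs] using hst.symm
  exact hy0 (by simp [hs, ht])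

lemma exists_planeVec_sum_eq_smul (hx : IsIntegral K x) (s t : K) :
    ∃ G : L, planeVec K L (∑ i : Fin ((minpoly K x).natDegree + 1),
        (s ^ ((minpoly K x).natDegree - (i : ℕ)) * t ^ (i : ℕ)) •
          lineChart p w (curveCoeff K x i)) =
      G • (s • ((p.1, p.2, (0 : L)) - x • (w.1, w.2, (1 : L))) + t • (w.1, w.2, (1 : L))) := by
  obtain ⟨G, c, hc, hsum⟩ := exists_sum_smul_curveCoeff_eq hx s t
  refine ⟨G, ?_⟩
  simp only [← map_smul, ← map_sum]
  rw [hsum, planeVec_lineChart, hc]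
  rw [← algebraMap_smul L s G, ← algebraMap_smul L s x, ← algebraMap_smul L s (_ - _),
    ← algebraMap_smul L t (_ : L × L × L), smul_eq_mul, smul_eq_mul]
  module

lemma sum_pow_mul_pow_smul_ne_zero {V : Type*} [AddCommGroup V] [Module K V] {d : ℕ}
    {e : Fin (d + 1) → V} (he : LinearIndependent K e) {s t : K} (hst : s ≠ 0 ∨ t ≠ 0) :
    ∑ i : Fin (d + 1), (s ^ (d - (i : ℕ)) * t ^ (i : ℕ)) • e i ≠ 0 := by
  intro h
  have hcoeff := Fintype.linearIndependent_iff.1 he _ h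
  rcases hst with hs | ht
  · exact pow_ne_zero d hs (by simpa using hcoeff 0)
  · exact pow_ne_zero d ht (by simpa using hcoeff (Fin.last d))

lemma isNormalRationalCurve_abbImage_linearSet [FiniteDimensional K L]
    (hcard : Module.finrank K L ≤ Nat.card K) (hx : x ∉ (algebraMap K L).range) (hp : p ≠ 0) :
    IsNormalRationalCurve (minpoly K x).natDegree (abbImage K (linearSet L
      (span K {(p.1, p.2, (0 : L)) - x • (w.1, w.2, (1 : L)), (w.1, w.2, (1 : L))}))) := by
  have hint : IsIntegral K x := Algebra.IsIntegral.isIntegral x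
  have hli : LinearIndependent K fun i => lineChart p w (curveCoeff K x i) :=
    (linearIndependent_curveCoeff hint).map' _ (LinearMap.ker_eq_bot.2 (lineChart_injective hp))
  have hext := isExternal_linearSet_of_notMem_range (p := p) (w := w) hx
  refine ⟨(minpoly.two_le_natDegree_iff hint).2 hx, (minpoly.natDegree_le x).trans hcard, _, hli,
    Set.Subset.antisymm ?_ ?_⟩
  · intro Q hQ
    have hQinf := Set.disjoint_left.1 hext.disjoint_abbImage hQ
    rw [abbImage_eq_preimage] at hQ
    obtain ⟨y, hy, hy0, hyQ⟩ := hQ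
    obtain ⟨s, t, rfl⟩ := Submodule.mem_span_pair.1 hy
    have hst : s ≠ 0 ∨ t ≠ 0 := by
      by_contra! hst
      exact hy0 (by simp [hst])
    have h := sum_pow_mul_pow_smul_ne_zero hli hst
    obtain ⟨G, hG⟩ := exists_planeVec_sum_eq_smul (p := p) (w := w) hint s t
    have hQeq : toPlane K L Q = toPlane K L (mk K _ h) :=
      hyQ.trans ((mk_eq_mk_iff' ..).2 ⟨G, hG.symm⟩).symm
    refine ⟨s, t, h, injOn_toPlane hQinf ?_ hQeq⟩
    rwa [Set.mem_compl_iff, ← toPlane_mem_lineAtInfinity_iff, ← hQeq,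
      toPlane_mem_lineAtInfinity_iff]
  · rintro Q ⟨s, t, h, rfl⟩
    obtain ⟨G, hG⟩ := exists_planeVec_sum_eq_smul (p := p) (w := w) hint s t
    have h0 := right_ne_zero_of_smul (hG ▸ planeVec_ne_zero h)
    rw [abbImage_eq_preimage]
    exact ⟨_, Submodule.mem_span_pair.2 ⟨s, t, rfl⟩, h0, (mk_eq_mk_iff' ..).2 ⟨G, hG.symm⟩⟩

lemma IsExternal.exists_linearSet_eq {u v : L × L × L} (huv : LinearIndependent L ![u, v])
    (hext : IsExternal (linearSet L (span K {u, v}))) :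
    ∃ (x : L) (p w : L × L), x ∉ (algebraMap K L).range ∧ p ≠ 0 ∧
      linearSet L (span K {u, v}) = linearSet L
        (span K {(p.1, p.2, (0 : L)) - x • (w.1, w.2, (1 : L)), (w.1, w.2, (1 : L))}) := by
  have hv : v.2.2 ≠ 0 := fun hv => one_ne_zero
    (hext.eq_zero_of_snd_snd_eq_zero huv (s := 0) (t := 1) (by simpa using hv)).2
  obtain ⟨x, hx⟩ : ∃ x : L, u.2.2 + x * v.2.2 = 0 :=
    ⟨-(u.2.2 / v.2.2), by rw [neg_mul, div_mul_cancel₀ _ hv, add_neg_cancel]⟩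
  let c := v.2.2⁻¹
  let p : L × L := (c * (u + x • v).1, c * (u + x • v).2.1)
  let w : L × L := (c * v.1, c * v.2.1)
  have hw : c • v = (w.1, w.2, 1) := by ext <;> simp [w, c, hv]
  have hp : c • (u + x • v) = (p.1, p.2, 0) := by
    ext
    · rfl
    · rfl
    · exact mul_eq_zero_of_right c hx
  refine ⟨x, p, w, ?_, ?_, ?_⟩
  · rintro ⟨y, rfl⟩
    refine one_ne_zero (hext.eq_zero_of_snd_snd_eq_zero huv (s := 1) (t := y) ?_).1
    simpa [Algebra.smul_def] using hx
  · intro hp₀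
    refine one_ne_zero (LinearIndependent.pair_iff.1 huv 1 x ?_).1
    simpa only [one_smul] using
      (smul_eq_zero.1 (hp.trans (by rw [hp₀]; rfl))).resolve_left (inv_ne_zero hv)
  · rw [← hp, ← hw, ← linearSet_span_smul (inv_ne_zero hv), smul_comm x c, ← smul_sub,
      add_sub_cancel_right]

lemma IsSubline.exists_isNormalRationalCurve_abbImage [FiniteDimensional K L]
    {m : Set (ℙ L (L × L × L))} (hm : IsSubline K 1 m) (hext : IsExternal m)
    (hcard : Module.finrank K L ≤ Nat.card K) : ∃ d, IsNormalRationalCurve d (abbImage K m) := by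
  obtain ⟨u, v, huv, rfl⟩ := isSubline_one_iff.1 hm
  obtain ⟨x, p, w, hx, hp, heq⟩ := hext.exists_linearSet_eq huv
  exact heq ▸ ⟨_, isNormalRationalCurve_abbImage_linearSet hcard hx hp⟩

end RationalCurve

section ThreePoints

variable {K L : Type*} [Field K] [Field L] [Algebra K L]

variable {m m' : Set (ℙ L (L × L × L))} {X Y Z : ℙ K (L × L × K)}

lemma IsExternal.toPlane_ne (hext : IsExternal m) (hX : X ∈ abbImage K m) (hY : Y ∈ abbImage K m)
    (h : X ≠ Y) : toPlane K L X ≠ toPlane K L Y :=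
  injOn_toPlane.ne (Set.disjoint_left.1 hext.disjoint_abbImage hX)
    (Set.disjoint_left.1 hext.disjoint_abbImage hY) h

lemma IsSubline.exists_isFrame_toPlane {k : ℕ} (hm : IsSubline K k m) (hext : IsExternal m)
    (hX : X ∈ abbImage K m) (hY : Y ∈ abbImage K m) (hZ : Z ∈ abbImage K m)
    (hXY : X ≠ Y) (hXZ : X ≠ Z) (hYZ : Y ≠ Z) :
    ∃ u v, IsFrame (toPlane K L X) (toPlane K L Y) (toPlane K L Z) u v ∧
      linearSet L (span K {u, v}) ⊆ m := by
  have hXY' := hext.toPlane_ne hX hY hXY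
  have hXZ' := hext.toPlane_ne hX hZ hXZ
  have hYZ' := hext.toPlane_ne hY hZ hYZ
  obtain ⟨F, -, u, v, -, rfl⟩ := isSubline_iff.1 hm
  rw [abbImage_eq_preimage] at hX hY hZ
  obtain ⟨u', v', hframe, hspan⟩ := exists_isFrame hX hY hZ hXY' hXZ' hYZ'
  exact ⟨u', v', hframe, hspan ▸ linearSet_mono (Submodule.span_le_restrictScalars ..)⟩

lemma IsSubline.not_isCollinear {k : ℕ} (hm : IsSubline K k m) (hext : IsExternal m)
    (hX : X ∈ abbImage K m) (hY : Y ∈ abbImage K m) (hZ : Z ∈ abbImage K m)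
    (hXY : X ≠ Y) (hXZ : X ≠ Z) (hYZ : Y ≠ Z) : ¬ IsCollinear {X, Y, Z} := by
  obtain ⟨u, v, hframe, hsub⟩ := hm.exists_isFrame_toPlane hext hX hY hZ hXY hXZ hYZ
  exact hframe.not_isCollinear (hext.mono hsub)

lemma IsSubline.eq_of_triple_subset (hm : IsSubline K 1 m) (hm' : IsSubline K 1 m')
    (hext : IsExternal m) (h : {X, Y, Z} ⊆ abbImage K m) (h' : {X, Y, Z} ⊆ abbImage K m')
    (hXY : X ≠ Y) (hXZ : X ≠ Z) (hYZ : Y ≠ Z) : m' = m := by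
  have hXY' := hext.toPlane_ne (h (by simp)) (h (by simp)) hXY
  have hXZ' := hext.toPlane_ne (h (by simp)) (h (by simp)) hXZ
  have hYZ' := hext.toPlane_ne (h (by simp)) (h (by simp)) hYZ
  obtain ⟨u, v, -, rfl⟩ := isSubline_one_iff.1 hm
  obtain ⟨u', v', -, rfl⟩ := isSubline_one_iff.1 hm'
  rw [abbImage_eq_preimage, ← Set.image_subset_iff] at h h'
  simp only [Set.image_insert_eq, Set.image_singleton] at h h'
  exact linearSet_span_pair_eq_of_three_mem h h' hXY' hXZ' hYZ'

lemma IsSubline.exists_subline_of_triple {k : ℕ} (hm : IsSubline K k m) (hext : IsExternal m)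
    (hX : X ∈ abbImage K m) (hY : Y ∈ abbImage K m) (hZ : Z ∈ abbImage K m)
    (hXY : X ≠ Y) (hXZ : X ≠ Z) (hYZ : Y ≠ Z) :
    ∃ m₀ ⊆ m, IsSubline K 1 m₀ ∧ {X, Y, Z} ⊆ abbImage K m₀ := by
  obtain ⟨u, v, hframe, hsub⟩ := hm.exists_isFrame_toPlane hext hX hY hZ hXY hXZ hYZ
  refine ⟨_, hsub, isSubline_one_iff.2 ⟨u, v, hframe.linearIndependent, rfl⟩, ?_⟩
  rw [abbImage_eq_preimage, ← Set.image_subset_iff, Set.image_insert_eq, Set.image_pair]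
  exact hframe.triple_subset

lemma IsSubline.ncard_abbImage [Finite K] [FiniteDimensional K L] {k : ℕ} (hm : IsSubline K k m)
    (hext : IsExternal m) : (abbImage K m).ncard = Nat.card K ^ k + 1 := by
  rw [hext.ncard_abbImage]
  obtain ⟨F, rfl, u, v, huv, rfl⟩ := isSubline_iff.1 hm
  have : Finite F := Module.finite_of_finite K
  rw [ncard_linearSet_span_pair huv, Module.natCard_eq_pow_finrank (K := K)]

lemma IsSubline.nonempty {k : ℕ} (hm : IsSubline K k m) : m.Nonempty := by
  obtain ⟨F, -, u, v, huv, rfl⟩ := isSubline_iff.1 hm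
  exact ⟨_, u, Submodule.subset_span (by simp), huv.ne_zero 0, rfl⟩

end ThreePoints

end ABB

theorem corollary2p7_general {K L : Type*} [Field K] [Finite K] [Field L] [Algebra K L]
    [FiniteDimensional K L] {k r : ℕ} (hcard : Module.finrank K L ≤ Nat.card K)
    {m m' : Set (ℙ L (L × L × L))} (hm : ABB.IsSubline K k m) (hext : ABB.IsExternal m)
    (hm' : ABB.IsSubline K r m') (hinf : ¬ ABB.IsExternal m') (hsub : m ⊆ m') :
    ((ABB.abbImage K m).ncard = Nat.card K ^ k + 1 ∧
      Disjoint (ABB.abbImage K m) (ABB.hyperplaneAtInfinity K L)) ∧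
    (∀ X ∈ ABB.abbImage K m, ∀ Y ∈ ABB.abbImage K m, ∀ Z ∈ ABB.abbImage K m,
      X ≠ Y → X ≠ Z → Y ≠ Z → ¬ Projectivization.IsCollinear {X, Y, Z}) ∧
    (∃ W : Projectivization.Subspace K (L × L × K),
      Module.finrank K W.submodule = r + 1 ∧ ABB.abbImage K m ⊆ W ∧
      (W : Set (ℙ K (L × L × K))) ∩ ABB.hyperplaneAtInfinity K L ∈ ABB.subspread K L r) ∧
    (∀ X ∈ ABB.abbImage K m, ∀ Y ∈ ABB.abbImage K m, ∀ Z ∈ ABB.abbImage K m,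
      X ≠ Y → X ≠ Z → Y ≠ Z → ∃ m₀ : Set (ℙ L (L × L × L)),
        (ABB.IsSubline K 1 m₀ ∧ {X, Y, Z} ⊆ ABB.abbImage K m₀) ∧
        (∀ m₁, ABB.IsSubline K 1 m₁ → {X, Y, Z} ⊆ ABB.abbImage K m₁ → m₁ = m₀) ∧
        (∃ d, ABB.IsNormalRationalCurve d (ABB.abbImage K m₀)) ∧
        Disjoint (ABB.abbImage K m₀) (ABB.hyperplaneAtInfinity K L) ∧
        ABB.abbImage K m₀ ⊆ ABB.abbImage K m) := by
  have haffine := hext.disjoint_abbImage (K := K)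
  obtain ⟨P, hP⟩ := hm.nonempty
  obtain ⟨W, hrank, hW, hspread⟩ := hm'.exists_subspace hinf fun h =>
    Set.disjoint_left.1 hext hP (h (hsub hP))
  refine ⟨⟨hm.ncard_abbImage hext, haffine⟩,
    fun X hX Y hY Z hZ hXY hXZ hYZ => hm.not_isCollinear hext hX hY hZ hXY hXZ hYZ,
    ⟨W, hrank, fun Q hQ => hW ⟨Set.biUnion_subset_biUnion_left hsub hQ,
      Set.disjoint_left.1 haffine hQ⟩, hspread⟩,
    fun X hX Y hY Z hZ hXY hXZ hYZ => ?_⟩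
  obtain ⟨m₀, hm₀m, hm₀, hXYZ⟩ := hm.exists_subline_of_triple hext hX hY hZ hXY hXZ hYZ
  have hext₀ := hext.mono hm₀m
  refine ⟨m₀, ⟨hm₀, hXYZ⟩,
    fun m₁ hm₁ h₁ => hm₀.eq_of_triple_subset hm₁ hext₀ hXYZ h₁ hXY hXZ hYZ,
    hm₀.exists_isNormalRationalCurve_abbImage hext₀ hcard, hext₀.disjoint_abbImage,
    Set.biUnion_subset_biUnion_left hm₀m⟩

theorem corollary2p7 {K L : Type*} [Field K] [Finite K] [Field L] [Algebra K L]
    [FiniteDimensional K L] (q n k r : ℕ) (hq : Nat.card K = q)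
    (hn : Module.finrank K L = n) (hqn : n ≤ q)
    (m : Set (ℙ L (L × L × L))) (hm : ABB.IsSubline K k m) (hext : ABB.IsExternal m)
    (hr : ABB.SmallestTangentDegree K m r)
    (M : Set (ℙ K (L × L × K))) (hM : M = ABB.abbImage K m) :
    -- `M` consists of `q ^ k + 1` affine points
    (M.ncard = q ^ k + 1 ∧ Disjoint M (ABB.hyperplaneAtInfinity K L)) ∧
    -- no three of which are collinear
    (∀ X ∈ M, ∀ Y ∈ M, ∀ Z ∈ M, X ≠ Y → X ≠ Z → Y ≠ Z →
      ¬ Projectivization.IsCollinear ({X, Y, Z} : Set (ℙ K (L × L × K)))) ∧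
    -- and is contained in an `r`-space meeting the hyperplane at infinity in an element of `D_r`
    (∃ W : Projectivization.Subspace K (L × L × K),
      Module.finrank K W.submodule = r + 1 ∧ M ⊆ W ∧
      (W : Set (ℙ K (L × L × K))) ∩ ABB.hyperplaneAtInfinity K L ∈ ABB.subspread K L r) ∧
    -- any three points of `M` determine a curve `C`, the ABB-image of the one and only
    -- `𝔽_q`-subline whose ABB-image contains them; `C` is an affine normal rational curve
    -- all of whose points belong to `M`
    (∀ X ∈ M, ∀ Y ∈ M, ∀ Z ∈ M, X ≠ Y → X ≠ Z → Y ≠ Z →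
      ∃ m₀ : Set (ℙ L (L × L × L)),
        (ABB.IsSubline K 1 m₀ ∧ {X, Y, Z} ⊆ ABB.abbImage K m₀) ∧
        (∀ m₁, ABB.IsSubline K 1 m₁ → {X, Y, Z} ⊆ ABB.abbImage K m₁ → m₁ = m₀) ∧
        (∃ d, ABB.IsNormalRationalCurve d (ABB.abbImage K m₀)) ∧
        Disjoint (ABB.abbImage K m₀) (ABB.hyperplaneAtInfinity K L) ∧
        ABB.abbImage K m₀ ⊆ M) := by
  obtain ⟨⟨m', hm', ⟨P, ⟨hP, hPinf⟩, -⟩, hsub⟩, -⟩ := hr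
  subst hq hn hM
  exact corollary2p7_general hqn hm hext hm' (Set.not_disjoint_iff.2 ⟨P, hP, hPinf⟩) hsub
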